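/- Setting. Let $\mathcal X=\mathbb N\times\mathbb N$; $\Delta(\mathcal X)$ is the set of probability distributions on $\mathcal X$, $d_{\mathrm{TV}}$ is total variation distance, and samples are finite multisets over $\mathcal X$. A learner $A$ maps samples to elements of $\Delta(\mathcal X)$. A class $\mathcal C\subset\Delta(\mathcal X)$ is realizably learnable with sample complexity $M:(0,1)^2\to\mathbb N$ if there is a learner $A$ such that for all $p\in\mathcal C$, $\epsilon,\delta\in(0,1)$ and $m\ge M(\epsilon,\delta)$, with probability at least $1-\delta$ over an i.i.d. sample $S\sim p^m$, $d_{\mathrm{TV}}(A(S),p)\le\epsilon$. An adaptive adversary $V$ is a randomized map from samples to samples, with no access to $p$; it is additive if always $S\subseteq V(S)$ and subtractive if always $V(S)\subseteq S$ (as multisets). Its budget at size $m$ is $\mathrm{budget}(V,m)=\sup_{|S|=m}(|V(S)|-|S|)/m$ if it is additive, and $\sup_{|S|=m}(|S|-|V(S)|)/m$ if it is subtractive. Only adversaries with fixed constant budget are considered: $|V(S)|$ depends only on $|S|$, and there is $\mathrm{budget}(V)=\eta\in[0,1]$ with $\eta m-1<m\cdot\mathrm{budget}(V,m)\le\eta m$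 for all $m$. A class $\mathcal C$ is adaptively $\alpha$-robustly learnable with respect to a set $\mathcal V$ of such adversaries if there are a learner $A$ and $M:(0,1)^2\to\mathbb N$ such that for all $p\in\mathcal C$, $V\in\mathcal V$, $\epsilon,\delta\in(0,1)$ and $m\ge M(\epsilon,\delta)$, with probability at least $1-\delta$ over $S\sim p^m$ and the randomness of $V$, $d_{\mathrm{TV}}(A(V(S)),p)\le\alpha\,\mathrm{budget}(V)+\epsilon$. It is adaptively additively (subtractively) $\alpha$-robustly learnable if this holds for $\mathcal V$ the set of all additive (subtractive) adversaries. An adversary $V$ is a universal $\alpha$-adversary for $\mathcal C$ if $\mathcal C$ is not adaptively $\alpha$-robustly learnable with respect to $\{V\}$. The class. Let $(B_i)_{i\in\mathbb N}$ be an enumeration of the finite subsets of $\mathbb N$. For $g:\mathbb R\to\mathbb R$ let $\mathcal C_g$ be the set of all distributions $$p_{i,j,g(j)}=\Bigl(1-\tfrac1j\Bigr)\delta_{(0,0)}+\Bigl(\tfrac1j-\tfrac1{g(j)}\Bigr)U_{B_i\times\{2j+1\}}+\tfrac1{g(j)}\,\delta_{(i,2j+2)}$$ with $i,j\in\mathbb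 N$, $j\ge1$, $B_i\neq\emptyset$ and $g(j)\ge j$, where $U_F$ is the uniform distribution on $F$. Theorem 1. Let $g:\mathbb R\to\mathbb R$ be superlinear, i.e. $g(x)/x\to\infty$ as $x\to\infty$. (a) If $g$ is nondecreasing on $[1,\infty)$, then $\mathcal C_g$ is realizably learnable with sample complexity $\max(0,\lceil\log(1/\delta)\,g(1/\epsilon)\rceil)$ (natural logarithm). (b) For every $\alpha\ge1$, $\mathcal C_g$ is not adaptively additively $\alpha$-robustly learnable; moreover, for every $\alpha\ge1$ there is an adaptive additive adversary $V_{\mathrm{add}}$ that is a universal $\alpha$-adversary for $\mathcal C_g$. (c) For every $\alpha\ge1$, $\mathcal C_g$ is not adaptively subtractively $\alpha$-robustly learnable; moreover, for every $\alpha\ge1$ there is an adaptive subtractive adversary $V_{\mathrm{sub}}$ that is a universal $\alpha$-adversary for $\mathcal C_g$. (d) Without any monotonicity assumption on $g$, there is a superlinear $h:\mathbb R\to\mathbb R$ such that $\mathcal C_h$ is realizably learnable with sample complexity $\max(0,\lceil\log(1/\delta)\,g(1/\epsilon)\rceil)$ and satisfies (b) and (c) in place of $\mathcal C_g$. -/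

import Mathlib

open Filter

namespace AdaptiveLearning

/-- The domain `ℕ × ℕ`. It is countable, so a `PMF` on it (or on the countable type of finite
multisets over it) is the same thing as a probability distribution on all subsets. -/
abbrev Point : Type := ℕ × ℕ

/-- Samples are finite multisets of points. -/
abbrev Sample : Type := Multiset Point

/-- The probability of an event. -/
noncomputable def prob {X : Type} (p : PMF X) (E : Set X) : ℝ := (p.toOuterMeasure E).toReal

/-- Total variation distance: the supremum over all events of the difference of probabilities. -/
noncomputable def tvDist {X : Type} (p q : PMF X) : ℝ := ⨆ E : Set X, |prob p E - prob q E|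

/-- The distribution `p ^ m` of an i.i.d. sample of size `m`, as a multiset. -/
noncomputable def iidSample (p : PMF Point) : ℕ → PMF Sample
  | 0 => PMF.pure 0
  | m + 1 => p.bind fun x => (iidSample p m).map fun S => x ::ₘ S

/-- A learner maps samples to distributions. -/
abbrev Learner : Type := Sample → PMF Point

/-- Realizable PAC learnability of the class `C` with sample complexity function `M`. -/
def RealizablyLearnableWith (C : Set (PMF Point)) (M : ℝ → ℝ → ℕ) : Prop :=
  ∃ A : Learner, ∀ p ∈ C, ∀ ε ∈ Set.Ioo (0 : ℝ) 1, ∀ δ ∈ Set.Ioo (0 : ℝ) 1, ∀ m : ℕ,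
    M ε δ ≤ m → 1 - δ ≤ prob (iidSample p m) {S | tvDist (A S) p ≤ ε}

/-- An adaptive adversary: a randomized function from samples to samples. -/
abbrev Adversary : Type := Sample → PMF Sample

/-- The distribution `V (p ^ m)` of the manipulated sample. -/
noncomputable def corruptedSample (V : Adversary) (p : PMF Point) (m : ℕ) : PMF Sample :=
  (iidSample p m).bind V

/-- The adversary only adds points. -/
def IsAdditive (V : Adversary) : Prop := ∀ S, ∀ T ∈ (V S).support, S ≤ T

/-- The adversary only removes points. -/
def IsSubtractive (V : Adversary) : Prop := ∀ S, ∀ T ∈ (V S).support, T ≤ S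

/-- The budget of an additive adversary at sample size `m`: `sup (|V S| - |S|) / m`. -/
noncomputable def addBudget (V : Adversary) (m : ℕ) : ℝ :=
  sSup {r : ℝ | ∃ S : Sample, S.card = m ∧ ∃ T ∈ (V S).support,
    r = ((T.card : ℝ) - (S.card : ℝ)) / m}

/-- The budget of a subtractive adversary at sample size `m`: `sup (|S| - |V S|) / m`. -/
noncomputable def subBudget (V : Adversary) (m : ℕ) : ℝ :=
  sSup {r : ℝ | ∃ S : Sample, S.card = m ∧ ∃ T ∈ (V S).support,
    r = ((S.card : ℝ) - (T.card : ℝ)) / m}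

/-- The size of the manipulated sample depends on the size of the sample only. -/
def HasFixedBudget (V : Adversary) : Prop :=
  ∀ S₁ S₂ : Sample, S₁.card = S₂.card →
    ∀ T₁ ∈ (V S₁).support, ∀ T₂ ∈ (V S₂).support, T₁.card = T₂.card

/-- The budget function `b` is constantly `η ∈ [0, 1]`, up to rounding. -/
def HasConstantBudget (b : ℕ → ℝ) (η : ℝ) : Prop :=
  0 ≤ η ∧ η ≤ 1 ∧ ∀ m : ℕ, η * m - 1 < m * b m ∧ m * b m ≤ η * m

/-- The adaptive additive adversaries `V`, each paired with its constant budget. -/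
def additiveAdversaries : Set (Adversary × ℝ) :=
  {v | IsAdditive v.1 ∧ HasFixedBudget v.1 ∧ HasConstantBudget (addBudget v.1) v.2}

/-- The adaptive subtractive adversaries `V`, each paired with its constant budget. -/
def subtractiveAdversaries : Set (Adversary × ℝ) :=
  {v | IsSubtractive v.1 ∧ HasFixedBudget v.1 ∧ HasConstantBudget (subBudget v.1) v.2}

/-- `C` is adaptively `α`-robustly learnable with respect to a class of adversaries, each given
with its budget. -/
def RobustlyLearnable (C : Set (PMF Point)) (α : ℝ) (𝒱 : Set (Adversary × ℝ)) : Prop :=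
  ∃ (A : Learner) (M : ℝ → ℝ → ℕ), ∀ p ∈ C, ∀ v ∈ 𝒱,
    ∀ ε ∈ Set.Ioo (0 : ℝ) 1, ∀ δ ∈ Set.Ioo (0 : ℝ) 1, ∀ m : ℕ, M ε δ ≤ m →
      1 - δ ≤ prob (corruptedSample v.1 p m) {S | tvDist (A S) p ≤ α * v.2 + ε}

/-- `v` is a universal `α`-adversary for `C`: every learner fails against this one adversary. -/
def IsUniversalAdversary (C : Set (PMF Point)) (α : ℝ) (v : Adversary × ℝ) : Prop :=
  ¬ RobustlyLearnable C α {v}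

theorem mixWeights_sum {j k : ℝ} (hj : 1 ≤ j) (hk : j ≤ k) :
    ∑ t : Fin 3, (![ENNReal.ofReal (1 - 1 / j), ENNReal.ofReal (1 / j - 1 / k),
      ENNReal.ofReal (1 / k)] : Fin 3 → ENNReal) t = 1 := by
  have h1 : 1 / j ≤ 1 := by rw [div_le_one (by linarith)]; exact hj
  have h2 : 1 / k ≤ 1 / j := one_div_le_one_div_of_le (by linarith) hk
  have h3 : 0 ≤ 1 / k := one_div_nonneg.2 (by linarith)
  simp only [Fin.sum_univ_three, Matrix.cons_val]
  rw [← ENNReal.ofReal_add (by linarith) (by linarith),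
    ← ENNReal.ofReal_add (by linarith) (by linarith)]
  simp

/-- The distribution on three components with weights `1 - 1/j`, `1/j - 1/k`, `1/k`. -/
noncomputable def mixWeights (j k : ℝ) (hj : 1 ≤ j) (hk : j ≤ k) : PMF (Fin 3) :=
  PMF.ofFintype ![ENNReal.ofReal (1 - 1 / j), ENNReal.ofReal (1 / j - 1 / k),
    ENNReal.ofReal (1 / k)] (mixWeights_sum hj hk)

/-- The mixture `(1 - 1/j) δ_(0,0) + (1/j - 1/k) U_(F × {2j+1}) + (1/k) δ_(i,2j+2)`. -/
noncomputable def mixture (F : Finset ℕ) (hF : F.Nonempty) (i j : ℕ) (k : ℝ)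
    (hj : (1 : ℝ) ≤ j) (hk : (j : ℝ) ≤ k) : PMF Point :=
  (mixWeights j k hj hk).bind
    ![PMF.pure (0, 0),
      PMF.uniformOfFinset (F ×ˢ {2 * j + 1}) (hF.product (Finset.singleton_nonempty _)),
      PMF.pure (i, 2 * j + 2)]

/-- The class `C_g` of all mixtures `p_(i,j,g(j))` that are defined: the set `B i` is nonempty,
`j ≥ 1` and all three weights are nonnegative, that is, `j ≤ g j`. -/
def classC (B : ℕ → Finset ℕ) (g : ℝ → ℝ) : Set (PMF Point) :=
  {p | ∃ (i j : ℕ) (hB : (B i).Nonempty) (hj : (1 : ℝ) ≤ j) (hk : (j : ℝ) ≤ g j),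
    p = mixture (B i) hB i j (g j) hj hk}

/-- `g` grows faster than linearly. -/
def Superlinear (g : ℝ → ℝ) : Prop := Tendsto (fun x => g x / x) atTop atTop

/-- `C` is realizably learnable from `log (1/δ) * g (1/ε)` samples, rounded up. -/
def RealizablyLearnableAtRate (C : Set (PMF Point)) (g : ℝ → ℝ) : Prop :=
  RealizablyLearnableWith C fun ε δ => ⌈Real.log (1 / δ) * g (1 / ε)⌉₊

/-- For no `α ≥ 1` is `C` adaptively additively `α`-robustly learnable, and for every `α ≥ 1`
some adaptive additive adversary is a universal `α`-adversary. -/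
def AdditivelyUnlearnable (C : Set (PMF Point)) : Prop :=
  ∀ α : ℝ, 1 ≤ α → ¬ RobustlyLearnable C α additiveAdversaries ∧
    ∃ v ∈ additiveAdversaries, IsUniversalAdversary C α v

/-- The same for adaptive subtractive adversaries. -/
def SubtractivelyUnlearnable (C : Set (PMF Point)) : Prop :=
  ∀ α : ℝ, 1 ≤ α → ¬ RobustlyLearnable C α subtractiveAdversaries ∧
    ∃ v ∈ subtractiveAdversaries, IsUniversalAdversary C α v

end AdaptiveLearning

namespace AdaptiveLearning

/-! ### Events, total variation and averaging for discrete distributions. -/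

section Probability

variable {X Y : Type}

/-! A marker `(i, 2j+2)` in the sample names the whole distribution, since it gives `i` and `j`. A
realizable learner therefore waits for a marker and answers `δ_(0,0)` until one appears. That answer
is within `1/j` of the truth, so a miss matters only when `j < 1/ε`; then the marker has mass
`1/g(j)`, and about `log (1/δ) * g(j)` draws find it (`realizablyLearnableAtRate_of_le`).

Superlinearity makes markers much rarer than the uniform part, which has mass about `1/j`. Fix one
`j` with `g(j) ≥ 64αj` and give the adversary budget `η = 1/(8αj)`. By Markov, with probability at
least `7/8` the markers take up at most the budget, while the allowed error `αη + ε` stays well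
below `1/j`. It remains to make the markers useless and to hide the uniform part.

For the latter, a set `x ⊆ {0, ..., 2m-1}` is encoded by choosing `2k+1` or `2k` for each `k`,
according to whether `k ∈ x`. A sample of size `m` shows at most `m` of these choices. Let `x'` be
`x` with all unseen choices flipped: the two uniform parts differ on at least half of their support,
yet the samples agree except for their markers. The subtractive adversary deletes the markers. The
additive one reads `x` and the seen choices off the sample and adds a marker of `x'` for each marker
of `x`; as flipping is an involution, `x` and `x'` produce the same sample.

No output is close to both distributions, so for a fixed underlying sample at most half of all `x`
are learned. Averaging over `x` bounds the success probability by `1/2 + 1/8 < 3/4`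
(`not_robustlyLearnable_of_flipUnseen`). -/

theorem toOuterMeasure_add_compl (p : PMF X) (E : Set X) :
    p.toOuterMeasure E + p.toOuterMeasure Eᶜ = 1 := by
  rw [PMF.toOuterMeasure_apply, PMF.toOuterMeasure_apply, ← ENNReal.tsum_add, ← p.tsum_coe]
  exact tsum_congr fun x => Set.indicator_self_add_compl_apply E p x

theorem toOuterMeasure_le_one (p : PMF X) (E : Set X) : p.toOuterMeasure E ≤ 1 :=
  (toOuterMeasure_add_compl p E).symm ▸ le_self_add

theorem toOuterMeasure_ne_top (p : PMF X) (E : Set X) : p.toOuterMeasure E ≠ ⊤ :=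
  ne_top_of_le_ne_top ENNReal.one_ne_top (toOuterMeasure_le_one p E)

theorem prob_nonneg (p : PMF X) (E : Set X) : 0 ≤ prob p E := ENNReal.toReal_nonneg

theorem prob_add_compl (p : PMF X) (E : Set X) : prob p E + prob p Eᶜ = 1 := by
  rw [prob, prob, ← ENNReal.toReal_add (toOuterMeasure_ne_top _ _) (toOuterMeasure_ne_top _ _),
    toOuterMeasure_add_compl, ENNReal.toReal_one]

theorem prob_le_one (p : PMF X) (E : Set X) : prob p E ≤ 1 := by
  linarith [prob_add_compl p E, prob_nonneg p Eᶜ]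

theorem prob_mono_of_support (p : PMF X) {E F : Set X} (h : ∀ x ∈ p.support, x ∈ E → x ∈ F) :
    prob p E ≤ prob p F :=
  ENNReal.toReal_mono (toOuterMeasure_ne_top _ _)
    (p.toOuterMeasure_mono fun x hx => h x hx.2 hx.1)

theorem prob_eq_zero_of_support (p : PMF X) {E : Set X} (h : ∀ x ∈ p.support, x ∉ E) :
    prob p E = 0 := by
  rw [prob, (p.toOuterMeasure_apply_eq_zero_iff E).2 (Set.disjoint_left.2 h), ENNReal.toReal_zero]

theorem prob_mono (p : PMF X) {E F : Set X} (h : E ⊆ F) : prob p E ≤ prob p F :=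
  prob_mono_of_support p fun _ _ hx => h hx

theorem prob_univ (p : PMF X) : prob p Set.univ = 1 := by
  have h := prob_add_compl p Set.univ
  simpa [prob] using h

theorem prob_map (f : X → Y) (p : PMF X) (E : Set Y) : prob (p.map f) E = prob p (f ⁻¹' E) := by
  rw [prob, prob, PMF.toOuterMeasure_map_apply]

theorem prob_singleton (p : PMF X) (a : X) : prob p {a} = (p a).toReal := by
  rw [prob, PMF.toOuterMeasure_apply_singleton]

theorem abs_prob_sub_le_tvDist (p q : PMF X) (E : Set X) :
    |prob p E - prob q E| ≤ tvDist p q := by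
  refine le_ciSup (f := fun E : Set X => |prob p E - prob q E|) ⟨1, ?_⟩ E
  rintro _ ⟨F, rfl⟩
  have h1 := prob_nonneg p F
  have h2 := prob_nonneg q F
  have h3 := prob_le_one p F
  have h4 := prob_le_one q F
  exact abs_le.2 ⟨by linarith, by linarith⟩

theorem tvDist_self (p : PMF X) : tvDist p p = 0 := by simp [tvDist]

theorem tvDist_pure_le (a : X) (p : PMF X) : tvDist (PMF.pure a) p ≤ 1 - prob p {a} := by
  refine ciSup_le fun E => ?_
  have h1 := prob_le_one p E
  have h0 := prob_nonneg p E
  by_cases ha : a ∈ E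
  · have h2 : prob (PMF.pure a) E = 1 := by simp [prob, PMF.toOuterMeasure_pure_apply, ha]
    have h3 : prob p {a} ≤ prob p E := prob_mono p (by simpa using ha)
    rw [h2, abs_of_nonneg (by linarith)]
    linarith
  · have h2 : prob (PMF.pure a) E = 0 := by simp [prob, PMF.toOuterMeasure_pure_apply, ha]
    have h3 : prob p {a} ≤ prob p Eᶜ := prob_mono p (by simpa using ha)
    rw [h2, zero_sub, abs_neg, abs_of_nonneg h0]
    linarith [prob_add_compl p E]

/-- Markov's inequality for a probability mass function. -/
theorem mul_toOuterMeasure_le_tsum (p : PMF X) (h : X → ENNReal) (a : ENNReal) :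
    a * p.toOuterMeasure {x | a ≤ h x} ≤ ∑' x, p x * h x := by
  rw [PMF.toOuterMeasure_apply, ← ENNReal.tsum_mul_left]
  refine ENNReal.tsum_le_tsum fun x => ?_
  by_cases hx : a ≤ h x
  · rw [Set.indicator_of_mem (by exact hx), mul_comm]
    gcongr
  · rw [Set.indicator_of_notMem (by exact hx)]
    simp

theorem tsum_bind_mul (p : PMF X) (f : X → PMF Y) (h : Y → ENNReal) :
    ∑' y, p.bind f y * h y = ∑' x, p x * ∑' y, f x y * h y := by
  simp_rw [PMF.bind_apply, ← ENNReal.tsum_mul_right, ← ENNReal.tsum_mul_left]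
  rw [ENNReal.tsum_comm]
  simp_rw [mul_assoc]

theorem tsum_map_mul (p : PMF X) (f : X → Y) (h : Y → ENNReal) :
    ∑' y, p.map f y * h y = ∑' x, p x * h (f x) := by
  rw [PMF.map, tsum_bind_mul]
  refine tsum_congr fun x => ?_
  rw [tsum_eq_single (f x)]
  · simp [PMF.pure_apply]
  · intro y hy
    simp [PMF.pure_apply, hy]

/-- If outside of an event `N` at most half of the events `E i` occur, then the average
probability of the `E i` is at most `1/2` plus the probability of `N`. -/
theorem two_mul_sum_prob_le {ι : Type} (p : PMF X) (I : Finset ι) (E : ι → Set X) (N : Set X)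
    (h : ∀ x ∈ p.support, x ∉ N → ∀ J ⊆ I, (∀ i ∈ J, x ∈ E i) → 2 * J.card ≤ I.card) :
    2 * ∑ i ∈ I, prob p (E i) ≤ I.card * (1 + 2 * prob p N) := by
  classical
  -- After exchanging the sums, the bound holds pointwise: a point off `N` lies in at most half of
  -- the events, a point of `N` in at most all of them.
  have key : 2 * ∑ i ∈ I, p.toOuterMeasure (E i) ≤
      (I.card : ENNReal) * (1 + 2 * p.toOuterMeasure N) := by
    have e1 : (I.card : ENNReal) * (1 + 2 * p.toOuterMeasure N) =
        ∑' x, (I.card : ENNReal) * (p x + 2 * N.indicator p x) := by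
      rw [ENNReal.tsum_mul_left, ENNReal.tsum_add, ENNReal.tsum_mul_left, p.tsum_coe,
        PMF.toOuterMeasure_apply]
    simp_rw [e1, PMF.toOuterMeasure_apply]
    rw [← Summable.tsum_finsetSum (fun _ _ => ENNReal.summable), ← ENNReal.tsum_mul_left]
    refine ENNReal.tsum_le_tsum fun x => ?_
    have e2 : ∑ i ∈ I, (E i).indicator p x = ((I.filter fun i => x ∈ E i).card : ENNReal) * p x := by
      simp_rw [Set.indicator_apply]
      rw [← Finset.sum_filter, Finset.sum_const, nsmul_eq_mul]
    rw [e2]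
    by_cases hx : x ∈ p.support
    · by_cases hN : x ∈ N
      · rw [Set.indicator_of_mem hN, ← mul_assoc]
        have : ((I.filter fun i => x ∈ E i).card : ENNReal) ≤ I.card := by
          exact_mod_cast Finset.card_filter_le _ _
        calc 2 * ((I.filter fun i => x ∈ E i).card : ENNReal) * p x ≤ 2 * I.card * p x := by gcongr
          _ = I.card * (2 * p x) := by ring
          _ ≤ _ := by gcongr; exact le_add_self
      · rw [Set.indicator_of_notMem hN, ← mul_assoc]
        have := h x hx hN (I.filter fun i => x ∈ E i) (Finset.filter_subset _ _)
          (fun i hi => (Finset.mem_filter.1 hi).2)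
        simp only [mul_zero, add_zero]
        gcongr
        exact_mod_cast this
    · rw [PMF.mem_support_iff, not_not] at hx
      simp [hx]
  have hfin : ∀ F : Set X, p.toOuterMeasure F ≠ ⊤ := toOuterMeasure_ne_top p
  have hr := ENNReal.toReal_mono (ENNReal.mul_ne_top (ENNReal.natCast_ne_top _)
    (ENNReal.add_ne_top.2 ⟨ENNReal.one_ne_top, ENNReal.mul_ne_top (by simp) (hfin N)⟩)) key
  rw [ENNReal.toReal_mul, ENNReal.toReal_mul, ENNReal.toReal_sum (fun i _ => hfin _),
    ENNReal.toReal_add ENNReal.one_ne_top (ENNReal.mul_ne_top (by simp) (hfin N)),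
    ENNReal.toReal_mul] at hr
  simpa [prob] using hr

theorem uniformOfFinset_map [DecidableEq Y] (s : Finset X) (hs : s.Nonempty) (f : X → Y)
    (hf : Set.InjOn f s) :
    (PMF.uniformOfFinset s hs).map f = PMF.uniformOfFinset (s.image f) (hs.image f) := by
  ext y
  rw [PMF.map_apply, PMF.uniformOfFinset_apply, Finset.card_image_of_injOn hf]
  split_ifs with hy
  · obtain ⟨x, hx, rfl⟩ := Finset.mem_image.1 hy
    rw [tsum_eq_single x]
    · simp [hx]
    · intro x' hx'
      by_cases h : x' ∈ s
      · rw [if_neg fun e => hx' (hf h hx e.symm)]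
      · simp [h]
  · rw [ENNReal.tsum_eq_zero]
    intro x
    split_ifs with h
    · rw [PMF.uniformOfFinset_apply, if_neg]
      rintro hx
      exact hy (h ▸ Finset.mem_image_of_mem f hx)
    · rfl

end Probability

/-! ### I.i.d. samples: relabelling, misses and counts. -/

section Samples

/-- This couples the samples of all encoded distributions: each is a relabelling of one base sample.
-/
theorem iidSample_map (p : PMF Point) (f : Point → Point) (m : ℕ) :
    iidSample (p.map f) m = (iidSample p m).map (Multiset.map f) := by
  induction m with
  | zero => simp [iidSample, PMF.pure_map]
  | succ m ih =>
    simp only [iidSample, ih, PMF.map_bind, PMF.bind_map, PMF.map_comp]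
    congr 1
    funext x
    simp only [Function.comp_apply]
    congr 1
    funext S
    simp

theorem card_of_mem_support_iidSample {p : PMF Point} {m : ℕ} {S : Sample}
    (h : S ∈ (iidSample p m).support) : S.card = m := by
  induction m generalizing S with
  | zero => simp_all [iidSample]
  | succ m ih =>
    simp only [iidSample, PMF.mem_support_bind_iff, PMF.mem_support_map_iff] at h
    obtain ⟨x, -, T, hT, rfl⟩ := h
    simp [ih hT]

theorem mem_support_of_mem_sample {p : PMF Point} {m : ℕ} {S : Sample}
    (h : S ∈ (iidSample p m).support) {a : Point} (ha : a ∈ S) : a ∈ p.support := by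
  induction m generalizing S with
  | zero => simp_all [iidSample]
  | succ m ih =>
    simp only [iidSample, PMF.mem_support_bind_iff, PMF.mem_support_map_iff] at h
    obtain ⟨x, hx, T, hT, rfl⟩ := h
    rcases Multiset.mem_cons.1 ha with rfl | ha
    · exact hx
    · exact ih hT ha

theorem toOuterMeasure_iidSample_forall_notMem (p : PMF Point) (E : Set Point) (m : ℕ) :
    (iidSample p m).toOuterMeasure {S | ∀ a ∈ S, a ∉ E} = p.toOuterMeasure Eᶜ ^ m := by
  induction m with
  | zero => simp [iidSample, PMF.toOuterMeasure_pure_apply]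
  | succ m ih =>
    simp only [iidSample, PMF.toOuterMeasure_bind_apply, PMF.toOuterMeasure_map_apply]
    rw [pow_succ', ← ih]
    conv_rhs => rw [PMF.toOuterMeasure_apply p, ← ENNReal.tsum_mul_right]
    refine tsum_congr fun x => ?_
    by_cases hx : x ∈ E
    · have : (fun S : Sample => x ::ₘ S) ⁻¹' {S | ∀ a ∈ S, a ∉ E} = ∅ :=
        Set.eq_empty_of_forall_notMem fun S hS => hS x (Multiset.mem_cons_self x S) hx
      rw [this, MeasureTheory.measure_empty, mul_zero,
        Set.indicator_of_notMem (Set.notMem_compl_iff.2 hx), zero_mul]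
    · have : (fun S : Sample => x ::ₘ S) ⁻¹' {S | ∀ a ∈ S, a ∉ E} = {S | ∀ a ∈ S, a ∉ E} :=
        Set.ext fun S => (Multiset.forall_mem_cons).trans (and_iff_right hx)
      rw [this, Set.indicator_of_mem (Set.mem_compl hx)]

theorem prob_iidSample_forall_notMem (p : PMF Point) (E : Set Point) (m : ℕ) :
    prob (iidSample p m) {S | ∀ a ∈ S, a ∉ E} = (1 - prob p E) ^ m := by
  rw [prob, toOuterMeasure_iidSample_forall_notMem, ENNReal.toReal_pow, ← prob,
    ← prob_add_compl p E, add_sub_cancel_left]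

/-- Linearity of expectation, one draw at a time. -/
theorem tsum_iidSample_mul_countP (p : PMF Point) (Q : Point → Prop) [DecidablePred Q] (m : ℕ) :
    ∑' S, iidSample p m S * (S.countP Q : ENNReal) = m * p.toOuterMeasure {a | Q a} := by
  induction m with
  | zero =>
    simp only [iidSample, Nat.cast_zero, zero_mul, ENNReal.tsum_eq_zero]
    intro S
    by_cases h : S = 0 <;> simp [h, PMF.pure_apply]
  | succ m ih =>
    simp only [iidSample, tsum_bind_mul, tsum_map_mul, Multiset.countP_cons, Nat.cast_add,
      mul_add, ENNReal.tsum_add, ih, ENNReal.tsum_mul_right, PMF.tsum_coe, one_mul]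
    rw [PMF.toOuterMeasure_apply]
    push_cast
    rw [add_mul, one_mul]
    congr 1
    refine tsum_congr fun x => ?_
    by_cases h : Q x <;> simp [h]

/-- Markov's inequality for the number of sample points in an event. -/
theorem mul_prob_le_countP_le (p : PMF Point) (Q : Point → Prop) [DecidablePred Q] (m : ℕ) {t : ℝ} (ht : 0 ≤ t) :
    t * prob (iidSample p m) {S | t ≤ S.countP Q} ≤ m * prob p {a | Q a} := by
  have h := mul_toOuterMeasure_le_tsum (iidSample p m)
    (fun S => (S.countP Q : ENNReal)) (ENNReal.ofReal t)
  rw [tsum_iidSample_mul_countP] at h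
  have hr := ENNReal.toReal_mono
    (ENNReal.mul_ne_top (ENNReal.natCast_ne_top m) (toOuterMeasure_ne_top p _)) h
  rw [ENNReal.toReal_mul, ENNReal.toReal_mul, ENNReal.toReal_ofReal ht,
    ENNReal.toReal_natCast] at hr
  have hset : {S : Sample | ENNReal.ofReal t ≤ (S.countP Q : ENNReal)} =
      {S | t ≤ S.countP Q} := by
    ext S
    simp only [Set.mem_ofPred_eq]
    rw [← ENNReal.ofReal_natCast, ENNReal.ofReal_le_ofReal_iff (Nat.cast_nonneg _)]
  rwa [hset] at hr

end Samples

/-! ### The mixtures: probabilities, supports, separation in total variation. -/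

section Mixtures

variable {F : Finset ℕ} {hF : F.Nonempty} {i j : ℕ} {k : ℝ} {hj : (1 : ℝ) ≤ j} {hk : (j : ℝ) ≤ k}

theorem toOuterMeasure_mixture (E : Set Point) :
    (mixture F hF i j k hj hk).toOuterMeasure E =
      ENNReal.ofReal (1 - 1 / j) * (PMF.pure ((0, 0) : Point)).toOuterMeasure E +
      ENNReal.ofReal (1 / j - 1 / k) * (PMF.uniformOfFinset (F ×ˢ {2 * j + 1})
        (hF.product (Finset.singleton_nonempty _))).toOuterMeasure E +
      ENNReal.ofReal (1 / k) * (PMF.pure ((i, 2 * j + 2) : Point)).toOuterMeasure E := by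
  rw [mixture, PMF.toOuterMeasure_bind_apply, tsum_fintype, Fin.sum_univ_three]
  rfl

theorem mixture_weights_nonneg (hj : (1 : ℝ) ≤ j) (hk : (j : ℝ) ≤ k) :
    0 ≤ 1 - 1 / (j : ℝ) ∧ 0 ≤ 1 / (j : ℝ) - 1 / k ∧ 0 ≤ 1 / k := by
  have h1 : 1 / (j : ℝ) ≤ 1 := by rw [div_le_one (by linarith)]; exact hj
  have h2 : 1 / k ≤ 1 / (j : ℝ) := one_div_le_one_div_of_le (by linarith) hk
  exact ⟨by linarith, by linarith, one_div_nonneg.2 (by linarith)⟩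

theorem prob_mixture (E : Set Point) :
    prob (mixture F hF i j k hj hk) E =
      (1 - 1 / j) * prob (PMF.pure ((0, 0) : Point)) E +
      (1 / j - 1 / k) * prob (PMF.uniformOfFinset (F ×ˢ {2 * j + 1})
        (hF.product (Finset.singleton_nonempty _))) E +
      1 / k * prob (PMF.pure ((i, 2 * j + 2) : Point)) E := by
  obtain ⟨h1, h2, h3⟩ := mixture_weights_nonneg hj hk
  have hfin : ∀ (r : ℝ) (p : PMF Point), ENNReal.ofReal r * p.toOuterMeasure E ≠ ⊤ := fun r p =>
    ENNReal.mul_ne_top ENNReal.ofReal_ne_top (toOuterMeasure_ne_top _ _)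
  simp only [prob]
  rw [toOuterMeasure_mixture,
    ENNReal.toReal_add (ENNReal.add_ne_top.2 ⟨hfin _ _, hfin _ _⟩) (hfin _ _),
    ENNReal.toReal_add (hfin _ _) (hfin _ _)]
  simp only [ENNReal.toReal_mul, ENNReal.toReal_ofReal h1, ENNReal.toReal_ofReal h2,
    ENNReal.toReal_ofReal h3]

theorem le_prob_mixture_zero : 1 - 1 / (j : ℝ) ≤ prob (mixture F hF i j k hj hk) {(0, 0)} := by
  obtain ⟨h1, h2, h3⟩ := mixture_weights_nonneg hj hk
  rw [prob_mixture]
  have e : prob (PMF.pure ((0, 0) : Point)) {(0, 0)} = 1 := by simp [prob_singleton]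
  rw [e, mul_one, add_assoc]
  exact le_add_of_nonneg_right
    (add_nonneg (mul_nonneg h2 (prob_nonneg _ _)) (mul_nonneg h3 (prob_nonneg _ _)))

theorem le_prob_mixture_marker : 1 / k ≤ prob (mixture F hF i j k hj hk) {(i, 2 * j + 2)} := by
  obtain ⟨h1, h2, h3⟩ := mixture_weights_nonneg hj hk
  rw [prob_mixture]
  have e : prob (PMF.pure ((i, 2 * j + 2) : Point)) {(i, 2 * j + 2)} = 1 := by
    simp [prob_singleton]
  rw [e, mul_one]
  exact le_add_of_nonneg_left
    (add_nonneg (mul_nonneg h1 (prob_nonneg _ _)) (mul_nonneg h2 (prob_nonneg _ _)))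

theorem mem_support_mixture {a : Point} (ha : a ∈ (mixture F hF i j k hj hk).support) :
    a = (0, 0) ∨ (a.1 ∈ F ∧ a.2 = 2 * j + 1) ∨ a = (i, 2 * j + 2) := by
  rw [mixture, PMF.mem_support_bind_iff] at ha
  obtain ⟨t, -, ht⟩ := ha
  fin_cases t
  · left; simpa using ht
  · right; left
    have h := (PMF.mem_support_uniformOfFinset_iff
      (hF.product (Finset.singleton_nonempty (2 * j + 1))) a).1 ht
    exact ⟨(Finset.mem_product.1 h).1, Finset.mem_singleton.1 (Finset.mem_product.1 h).2⟩
  · right; right; simpa using ht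

theorem prob_mixture_marker : prob (mixture F hF i j k hj hk) {a | a.2 = 2 * j + 2} = 1 / k := by
  rw [prob_mixture]
  have h0 : prob (PMF.pure ((0, 0) : Point)) {a | a.2 = 2 * j + 2} = 0 := by
    simp [prob, PMF.toOuterMeasure_pure_apply]
  have h1 : prob (PMF.pure ((i, 2 * j + 2) : Point)) {a | a.2 = 2 * j + 2} = 1 := by
    simp [prob, PMF.toOuterMeasure_pure_apply]
  have h3 : prob (PMF.uniformOfFinset (F ×ˢ {2 * j + 1})
      (hF.product (Finset.singleton_nonempty _))) {a | a.2 = 2 * j + 2} = 0 := by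
    refine prob_eq_zero_of_support _ fun a ha h => ?_
    have h3 := (PMF.mem_support_uniformOfFinset_iff _ a).1 ha
    have h4 : a.2 = 2 * j + 1 := Finset.mem_singleton.1 (Finset.mem_product.1 h3).2
    have h5 : a.2 = 2 * j + 2 := h
    omega
  rw [h0, h1, h3]
  ring

/-- A distribution that is `r`-close to two mixtures bounds the part of the support by which these
differ. -/
theorem card_sdiff_le_of_tvDist_le {F' : Finset ℕ} {hF' : F'.Nonempty} {i' : ℕ} {q : PMF Point}
    {r : ℝ} (h : tvDist q (mixture F hF i j k hj hk) ≤ r)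
    (h' : tvDist q (mixture F' hF' i' j k hj hk) ≤ r) :
    (1 / j - 1 / k) * ((F \ F').card / F.card) ≤ 2 * r := by
  classical
  obtain ⟨w1, w2, w3⟩ := mixture_weights_nonneg hj hk
  -- This event is null for the second mixture and meets the uniform part of the first in `(F \ F')
  -- × {2j+1}`.
  let E : Set Point := {a | a.1 ∉ F' ∧ a.2 = 2 * j + 1}
  have e1 : prob (mixture F' hF' i' j k hj hk) E = 0 := by
    refine prob_eq_zero_of_support _ fun a ha hE => ?_
    rcases mem_support_mixture ha with rfl | e | rfl
    · exact absurd hE.2 (by simp)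
    · exact hE.1 e.1
    · exact absurd hE.2 (by simp)
  have e2 : (1 / j - 1 / k) * ((F \ F').card / F.card) ≤
      prob (mixture F hF i j k hj hk) E := by
    have e3 : prob (PMF.uniformOfFinset (F ×ˢ {2 * j + 1})
        (hF.product (Finset.singleton_nonempty _))) E = (F \ F').card / F.card := by
      have (_ : DecidablePred (· ∈ E)) :
          (F ×ˢ {2 * j + 1}).filter (· ∈ E) = (F \ F') ×ˢ {2 * j + 1} := by
        ext a
        simp only [E, Set.mem_ofPred_eq, Finset.mem_filter, Finset.mem_product,
          Finset.mem_singleton, Finset.mem_sdiff]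
        tauto
      rw [prob, PMF.toOuterMeasure_uniformOfFinset_apply]
      rw [this]
      simp
    rw [prob_mixture, e3]
    have := mul_nonneg w1 (prob_nonneg (PMF.pure ((0, 0) : Point)) E)
    have := mul_nonneg w3 (prob_nonneg (PMF.pure ((i, 2 * j + 2) : Point)) E)
    linarith
  have h1 := (abs_le.1 ((abs_prob_sub_le_tvDist _ _ E).trans h)).1
  have h2 := (abs_le.1 ((abs_prob_sub_le_tvDist _ _ E).trans h')).2
  linarith

theorem map_mixture (f : Point → Point) (G : Finset ℕ) (hG : G.Nonempty) (i' : ℕ)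
    (h0 : f (0, 0) = (0, 0)) (hinj : Set.InjOn f (F ×ˢ {2 * j + 1} : Finset Point))
    (himg : (F ×ˢ {2 * j + 1}).image f = G ×ˢ {2 * j + 1})
    (hmark : f (i, 2 * j + 2) = (i', 2 * j + 2)) :
    (mixture F hF i j k hj hk).map f = mixture G hG i' j k hj hk := by
  rw [mixture, mixture, PMF.map_bind]
  congr 1
  funext t
  fin_cases t
  · simp [PMF.pure_map, h0]
  · simp only [Fin.mk_one, Matrix.cons_val_one, Matrix.cons_val_zero]
    rw [uniformOfFinset_map _ _ _ hinj]
    congr 1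
  · simp [PMF.pure_map, hmark]

end Mixtures

/-! ### Realizable learning from a marker. -/

section Realizable

/-- A marker has to be found only if `j < 1/ε`, so `h j ≤ g x` is needed only for `x > j`, and only
for those `j` that occur in the class. Separating `h` from `g` lets the same argument serve monotone
`g` and the lower envelope. -/
theorem realizablyLearnableAtRate_of_le {B : ℕ → Finset ℕ} {h g : ℝ → ℝ}
    (hg : ∀ j : ℕ, (1 : ℝ) ≤ j → (j : ℝ) ≤ h j → ∀ x : ℝ, (j : ℝ) < x → h j ≤ g x) :
    RealizablyLearnableAtRate (classC B h) g := by
  classical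
  let Q : Sample → PMF Point → Prop := fun S q =>
    ∃ (i j : ℕ) (hB : (B i).Nonempty) (hj : (1 : ℝ) ≤ j) (hk : (j : ℝ) ≤ h j),
      (i, 2 * j + 2) ∈ S ∧ q = mixture (B i) hB i j (h j) hj hk
  refine ⟨fun S => if H : ∃ q, Q S q then H.choose else PMF.pure (0, 0), ?_⟩
  rintro p ⟨i, j, hB, hj, hk, rfl⟩ ε ⟨hε, -⟩ δ ⟨hδ, hδ1⟩ m hm
  set p := mixture (B i) hB i j (h j) hj hk with hp
  -- The other support points have second coordinate `0` or odd, so a marker in the sample is the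
  -- true one and determines the mixture.
  have hQ : ∀ S ∈ (iidSample p m).support, ∀ q, Q S q → q = p := by
    rintro S hS q ⟨i', j', hB', hj', hk', hmem, rfl⟩
    have hj1 : 1 ≤ j' := by exact_mod_cast hj'
    rcases mem_support_mixture (mem_support_of_mem_sample hS hmem) with e | e | e
    · simp at e
    · have := e.2; simp only at this; omega
    · simp only [Prod.mk.injEq] at e
      obtain ⟨rfl, e⟩ := e
      obtain rfl : j' = j := by omega
      rfl
  have hA : ∀ S ∈ (iidSample p m).support, ∀ H : ∃ q, Q S q,
      tvDist (if H : ∃ q, Q S q then H.choose else PMF.pure (0, 0)) p ≤ ε := by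
    intro S hS H
    rw [dif_pos H, hQ S hS _ H.choose_spec, tvDist_self]
    exact hε.le
  have hjpos : (0 : ℝ) < j := by linarith
  rcases le_or_gt (1 / (j : ℝ)) ε with hjε | hjε
  · have : prob (iidSample p m) Set.univ ≤ prob (iidSample p m)
        {S | tvDist (if H : ∃ q, Q S q then H.choose else PMF.pure (0, 0)) p ≤ ε} := by
      refine prob_mono_of_support _ fun S hS _ => ?_
      by_cases H : ∃ q, Q S q
      · exact hA S hS H
      · simp only [Set.mem_ofPred_eq, dif_neg H]
        have h1 := tvDist_pure_le (0, 0) p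
        have h2 : 1 - 1 / (j : ℝ) ≤ prob p {(0, 0)} := le_prob_mixture_zero
        linarith
    rw [prob_univ] at this
    linarith
  · have hjx : (j : ℝ) < 1 / ε := by
      rw [lt_div_iff₀ hjpos] at hjε
      rw [lt_div_iff₀ hε]
      linarith
    have hgx := hg j hj hk _ hjx
    have hpos : 0 < h j := by linarith
    have hlog : 0 < Real.log (1 / δ) := Real.log_pos (by rw [lt_div_iff₀ hδ]; linarith)
    have hm' : Real.log (1 / δ) * h j ≤ m := by
      have h1 : Real.log (1 / δ) * g (1 / ε) ≤ m := Nat.ceil_le.1 hm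
      nlinarith
    have hmiss : prob (iidSample p m) {S | ∀ a ∈ S, a ∉ ({(i, 2 * j + 2)} : Set Point)} ≤ δ := by
      rw [prob_iidSample_forall_notMem]
      have h1 : 1 / h j ≤ prob p {(i, 2 * j + 2)} := le_prob_mixture_marker
      have h2 := prob_le_one p {(i, 2 * j + 2)}
      calc (1 - prob p {(i, 2 * j + 2)}) ^ m ≤ Real.exp (-(1 / h j)) ^ m := by
            refine pow_le_pow_left₀ (by linarith) ?_ m
            linarith [Real.add_one_le_exp (-(1 / h j))]
        _ = Real.exp (-(m / h j)) := by
            rw [← Real.exp_nat_mul]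
            congr 1
            ring
        _ ≤ Real.exp (-Real.log (1 / δ)) := by
            rw [Real.exp_le_exp, neg_le_neg_iff, le_div_iff₀ hpos]
            exact hm'
        _ = δ := by rw [Real.log_div one_ne_zero hδ.ne', Real.log_one, zero_sub, neg_neg,
            Real.exp_log hδ]
    have hsub := prob_mono_of_support (iidSample p m)
      (E := {S | ∀ a ∈ S, a ∉ ({(i, 2 * j + 2)} : Set Point)}ᶜ)
      (F := {S | tvDist (if H : ∃ q, Q S q then H.choose else PMF.pure (0, 0)) p ≤ ε}) (by
        intro S hS hmem
        have : (i, 2 * j + 2) ∈ S := by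
          by_contra hcon
          exact hmem fun a ha e => hcon (Set.mem_singleton_iff.1 e ▸ ha)
        exact hA S hS ⟨p, i, j, hB, hj, hk, this, rfl⟩)
    have := prob_add_compl (iidSample p m)
      {S | ∀ a ∈ S, a ∉ ({(i, 2 * j + 2)} : Set Point)}
    linarith

/-- Below a superlinear function there is a superlinear function whose value at `x` bounds the
given function on `[x, ∞)` from below, wherever that value is positive. -/
theorem Superlinear.exists_lower_envelope {g : ℝ → ℝ} (hg : Superlinear g) :
    ∃ h : ℝ → ℝ, Superlinear h ∧ ∀ x, 0 < h x → ∀ y, x ≤ y → h x ≤ g y := by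
  have hbound : ∀ N : ℝ, ∃ x₀ : ℝ, 0 < x₀ ∧ ∀ x, x₀ ≤ x → N * x ≤ g x := by
    intro N
    obtain ⟨a, ha⟩ := eventually_atTop.1 (hg.eventually_ge_atTop N)
    refine ⟨max a 1, by positivity, fun x hx => ?_⟩
    have hx0 : 0 < x := lt_of_lt_of_le (by positivity) hx
    exact (le_div_iff₀ hx0).1 (ha x ((le_max_left _ _).trans hx))
  obtain ⟨x₀, -, hx₀⟩ := hbound 0
  -- From `x₀` on, `g` is nonnegative, so the infimum is a genuine lower bound. The default `0`
  -- before `x₀` is harmless because only positive values are claimed to bound `g`.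
  refine ⟨fun x => if x₀ ≤ x then sInf (g '' Set.Ici x) else 0, ?_, ?_⟩
  · refine tendsto_atTop.2 fun N => ?_
    obtain ⟨x₁, hpos, hx₁⟩ := hbound (max N 0)
    filter_upwards [eventually_ge_atTop x₀, eventually_ge_atTop x₁] with x h0 h1
    have hx : 0 < x := hpos.trans_le h1
    rw [if_pos h0, le_div_iff₀ hx]
    refine le_csInf ⟨g x, x, Set.self_mem_Ici, rfl⟩ ?_
    rintro _ ⟨y, hy, rfl⟩
    have hxy : x ≤ y := hy
    calc N * x ≤ max N 0 * y :=
          mul_le_mul (le_max_left _ _) hxy hx.le (le_max_right _ _)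
      _ ≤ g y := hx₁ y (h1.trans hxy)
  · intro x hx y hxy
    simp only at hx ⊢
    split_ifs at hx ⊢ with h0
    · refine csInf_le ⟨0, ?_⟩ ⟨y, hxy, rfl⟩
      rintro _ ⟨z, hz, rfl⟩
      simpa using hx₀ z (h0.trans hz)
    · exact absurd hx (lt_irrefl _)

end Realizable

/-! ### Parity encoding of subsets, and flipping the unseen part. -/

section Encoding

/-- Encodes whether `k ∈ x` in the parity. -/
def parityCode (x : Finset ℕ) (k : ℕ) : ℕ := if k ∈ x then 2 * k + 1 else 2 * k

theorem parityCode_div_two (x : Finset ℕ) (k : ℕ) : parityCode x k / 2 = k := by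
  unfold parityCode
  split_ifs <;> omega

theorem parityCode_injective (x : Finset ℕ) : Function.Injective (parityCode x) :=
  Function.LeftInverse.injective (g := (· / 2)) (parityCode_div_two x)

theorem parityCode_eq_iff {x y : Finset ℕ} {k l : ℕ} :
    parityCode x k = parityCode y l ↔ k = l ∧ (k ∈ x ↔ l ∈ y) := by
  unfold parityCode
  constructor
  · intro h
    split_ifs at h with h1 h2 h2
    all_goals first
      | omega
      | exact ⟨by omega, by simp [h1, h2]⟩
  · rintro ⟨rfl, h⟩
    simp only [h]

/-- The set that encodes which elements of `range n` belong to `x`. -/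
def codeSet (n : ℕ) (x : Finset ℕ) : Finset ℕ := (Finset.range n).image (parityCode x)

theorem card_codeSet (n : ℕ) (x : Finset ℕ) : (codeSet n x).card = n := by
  rw [codeSet, Finset.card_image_of_injective _ (parityCode_injective x), Finset.card_range]

theorem codeSet_nonempty {n : ℕ} (hn : 0 < n) (x : Finset ℕ) : (codeSet n x).Nonempty := by
  rw [← Finset.card_pos, card_codeSet]
  exact hn

/-- Each flipped `k` replaces one of `2k`, `2k+1` by the other, and no other index has either as its
code. -/
theorem card_le_card_codeSet_sdiff {n : ℕ} (x : Finset ℕ) {c : Finset ℕ}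
    (hc : c ⊆ Finset.range n) :
    c.card ≤ (codeSet n x \ codeSet n (symmDiff x c)).card := by
  rw [← Finset.card_image_of_injective c (parityCode_injective x)]
  refine Finset.card_le_card fun a ha => ?_
  obtain ⟨k, hk, rfl⟩ := Finset.mem_image.1 ha
  refine Finset.mem_sdiff.2 ⟨Finset.mem_image_of_mem _ (hc hk), fun h => ?_⟩
  obtain ⟨l, -, hl⟩ := Finset.mem_image.1 h
  obtain ⟨rfl, hiff⟩ := parityCode_eq_iff.1 hl
  rw [Finset.mem_symmDiff] at hiff
  tauto

/-- Recovers `x ⊆ range n` from `codeSet n x`. -/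
def decodeSet (n : ℕ) (F : Finset ℕ) : Finset ℕ := (Finset.range n).filter fun k => 2 * k + 1 ∈ F

theorem decodeSet_codeSet {n : ℕ} {x : Finset ℕ} (hx : x ⊆ Finset.range n) :
    decodeSet n (codeSet n x) = x := by
  ext k
  simp only [decodeSet, codeSet, Finset.mem_filter, Finset.mem_image]
  constructor
  · rintro ⟨-, l, -, hl⟩
    unfold parityCode at hl
    split_ifs at hl with h
    · obtain rfl : l = k := by omega
      exact h
    · omega
  · intro h
    exact ⟨hx h, k, hx h, by simp [parityCode, h]⟩

variable {B : ℕ → Finset ℕ} (hB : Function.Surjective B) (n j : ℕ)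

/-- An index of `codeSet n x` in the enumeration `B`. -/
noncomputable def codeIndex (x : Finset ℕ) : ℕ := Function.surjInv hB (codeSet n x)

theorem apply_codeIndex (x : Finset ℕ) : B (codeIndex hB n x) = codeSet n x :=
  Function.surjInv_eq hB _

/-- Maps the mixture with uniform part on `range n` to the one with uniform part on
`codeSet n x`. -/
noncomputable def encodePoint (x : Finset ℕ) (a : Point) : Point :=
  if a.2 = 2 * j + 1 then (parityCode x a.1, a.2)
  else if a.2 = 2 * j + 2 then (codeIndex hB n x, a.2) else a

theorem encodePoint_snd (x : Finset ℕ) (a : Point) : (encodePoint hB n j x a).2 = a.2 := by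
  unfold encodePoint
  split_ifs <;> rfl

theorem map_encodePoint_mixture {i : ℕ} {k : ℝ} {hn : (Finset.range n).Nonempty}
    {hj : (1 : ℝ) ≤ j} {hk : (j : ℝ) ≤ k} (x : Finset ℕ) (hx : (codeSet n x).Nonempty) :
    (mixture (Finset.range n) hn i j k hj hk).map (encodePoint hB n j x) =
      mixture (codeSet n x) hx (codeIndex hB n x) j k hj hk := by
  have hval : ∀ a, a ∈ Finset.range n ×ˢ {2 * j + 1} →
      encodePoint hB n j x a = (parityCode x a.1, 2 * j + 1) := by
    intro a ha
    have h : a.2 = 2 * j + 1 := Finset.mem_singleton.1 (Finset.mem_product.1 ha).2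
    rw [encodePoint, if_pos h, h]
  refine map_mixture _ _ _ _ ?_ ?_ ?_ ?_
  · simp [encodePoint]
  · intro a ha b hb hab
    rw [hval a ha, hval b hb, Prod.mk.injEq] at hab
    have h1 := Finset.mem_singleton.1 (Finset.mem_product.1 ha).2
    have h2 := Finset.mem_singleton.1 (Finset.mem_product.1 hb).2
    exact Prod.ext (parityCode_injective x hab.1) (h1.trans h2.symm)
  · rw [Finset.image_congr (g := Prod.map (parityCode x) id)]
    · rw [Finset.prodMap_image_product, Finset.image_id, codeSet]
    · intro a ha
      have h1 := Finset.mem_singleton.1 (Finset.mem_product.1 ha).2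
      rw [hval a ha, Prod.map_apply', h1]
      rfl
  · simp [encodePoint]

noncomputable def encodeSample (x : Finset ℕ) (S : Sample) : Sample :=
  S.map (encodePoint hB n j x)

/-- The indices `k` of the points `(k, 2j+1)` of a sample. -/
def seenIndices (S : Sample) : Finset ℕ := ((S.filter (·.2 = 2 * j + 1)).map Prod.fst).toFinset

theorem card_seenIndices_le (S : Sample) : (seenIndices j S).card ≤ S.card := by
  refine (Multiset.toFinset_card_le _).trans ?_
  rw [Multiset.card_map]
  exact Multiset.card_le_card (Multiset.filter_le _ _)

/-- Flips the membership in `x` of all indices that the sample does not reveal. -/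
def flipUnseen (S : Sample) (x : Finset ℕ) : Finset ℕ :=
  symmDiff x (Finset.range n \ seenIndices j S)

variable {n j}

theorem flipUnseen_flipUnseen (S : Sample) (x : Finset ℕ) :
    flipUnseen n j S (flipUnseen n j S x) = x := symmDiff_symmDiff_cancel_right _ _

theorem flipUnseen_subset (S : Sample) {x : Finset ℕ} (hx : x ⊆ Finset.range n) :
    flipUnseen n j S x ⊆ Finset.range n :=
  fun _ hk => (Finset.mem_symmDiff.1 hk).elim (fun h => hx h.1)
    fun h => (Finset.mem_sdiff.1 h.1).1

variable (n j)

theorem card_encodeSample (x : Finset ℕ) (S : Sample) :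
    (encodeSample hB n j x S).card = S.card := Multiset.card_map _ _

theorem filter_marker_encodeSample (x : Finset ℕ) (S : Sample) :
    (encodeSample hB n j x S).filter (·.2 = 2 * j + 2) =
      Multiset.replicate (S.countP (·.2 = 2 * j + 2)) (codeIndex hB n x, 2 * j + 2) := by
  rw [encodeSample, Multiset.filter_map, Multiset.eq_replicate, Multiset.card_map,
    Multiset.countP_eq_card_filter]
  constructor
  · simp only [Function.comp_def, encodePoint_snd]
  · intro b hb
    obtain ⟨a, ha, rfl⟩ := Multiset.mem_map.1 hb
    have h := (Multiset.mem_filter.1 ha).2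
    simp only [Function.comp_apply, encodePoint_snd] at h
    simp [encodePoint, h]

/-- Off the markers, the encoding depends on `x` only through the membership of the seen indices,
which the flip preserves. -/
theorem filter_not_marker_encodeSample_flipUnseen (x : Finset ℕ) (S : Sample) :
    (encodeSample hB n j (flipUnseen n j S x) S).filter (¬ ·.2 = 2 * j + 2) =
      (encodeSample hB n j x S).filter (¬ ·.2 = 2 * j + 2) := by
  rw [encodeSample, encodeSample, Multiset.filter_map, Multiset.filter_map]
  simp only [Function.comp_def, encodePoint_snd]
  refine Multiset.map_congr rfl fun a ha => ?_
  obtain ⟨haS, hne⟩ := Multiset.mem_filter.1 ha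
  unfold encodePoint
  split_ifs with h
  · have hseen : a.1 ∈ seenIndices j S := by
      rw [seenIndices, Multiset.mem_toFinset]
      exact Multiset.mem_map_of_mem _ (Multiset.mem_filter.2 ⟨haS, h⟩)
    have : parityCode (flipUnseen n j S x) a.1 = parityCode x a.1 := by
      rw [parityCode_eq_iff, flipUnseen, Finset.mem_symmDiff, Finset.mem_sdiff]
      tauto
    rw [this]
  · rfl

/-- The indices that an encoded sample reveals. -/
def revealedIndices (S : Sample) : Finset ℕ :=
  ((S.filter (·.2 = 2 * j + 1)).map (·.1 / 2)).toFinset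

/-- The adversary sees only the encoded sample; halving a code forgets `x` and returns the index. -/
theorem revealedIndices_encodeSample (x : Finset ℕ) (S : Sample) :
    revealedIndices j (encodeSample hB n j x S) = seenIndices j S := by
  rw [revealedIndices, seenIndices, encodeSample, Multiset.filter_map, Multiset.map_map]
  simp only [Function.comp_def, encodePoint_snd]
  congr 1
  refine Multiset.map_congr rfl fun a ha => ?_
  rw [encodePoint, if_pos (Multiset.mem_filter.1 ha).2]
  exact parityCode_div_two x a.1

end Encoding

/-! ### Averaging over all encoded sets defeats every learner. -/

section LowerBound

variable {B : ℕ → Finset ℕ} (hB : Function.Surjective B)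

theorem corruptedSample_pure (f : Sample → Sample) (p : PMF Point) (m : ℕ) :
    corruptedSample (fun S => PMF.pure (f S)) p m = (iidSample p m).map f := rfl

/-- A deterministic adversary defeats every learner if, whenever its budget allows it, it produces
the same sample from the encodings of a sample by `x` and by the set that differs from `x` in
exactly the indices that are not revealed. -/
theorem not_robustlyLearnable_of_flipUnseen {g : ℝ → ℝ} {α : ℝ} (hα : 1 ≤ α) {j : ℕ}
    (hj : (1 : ℝ) ≤ j) (hg : 64 * α * j ≤ g j) (f : Sample → Sample)
    (hf : ∀ (m : ℕ) (x : Finset ℕ) (S : Sample), x ⊆ Finset.range (2 * m) → S.card = m →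
      (S.countP (·.2 = 2 * j + 2) : ℝ) ≤ 1 / (8 * α * j) * m →
      f (encodeSample hB (2 * m) j (flipUnseen (2 * m) j S x) S) =
        f (encodeSample hB (2 * m) j x S)) :
    ¬ RobustlyLearnable (classC B g) α {(fun S => PMF.pure (f S), 1 / (8 * α * j))} := by
  classical
  rintro ⟨A, M, hAM⟩
  have hj0 : (0 : ℝ) < j := by linarith
  have hα0 : 0 < α := by linarith
  have hk : (j : ℝ) ≤ g j := by nlinarith
  have hgpos : 0 < g j := by linarith
  set ε : ℝ := 1 / (16 * j) with hε
  have hε0 : 0 < ε := by positivity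
  have hε1 : ε < 1 := by rw [hε, div_lt_one (by positivity)]; linarith
  -- The maximum with `1` keeps the code sets, of size `2 * m`, nonempty.
  set m : ℕ := max (M ε (1 / 4)) 1 with hm
  have hm1 : 1 ≤ m := le_max_right _ _
  have hm0 : (0 : ℝ) < m := by exact_mod_cast hm1
  have hne : ∀ x, (codeSet (2 * m) x).Nonempty := codeSet_nonempty (by omega)
  have hrange : (Finset.range (2 * m)).Nonempty := Finset.nonempty_range_iff.2 (by omega)
  let base := mixture (Finset.range (2 * m)) hrange 0 j (g j) hj hk
  let P : Finset ℕ → PMF Point := fun x =>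
    mixture (codeSet (2 * m) x) (hne x) (codeIndex hB (2 * m) x) j (g j) hj hk
  set r : ℝ := α * (1 / (8 * α * j)) + ε with hr
  have hr' : r = 3 / (16 * j) := by rw [hr, hε]; field_simp; norm_num
  let E : Finset ℕ → Set Sample := fun x =>
    {S | tvDist (A (f (encodeSample hB (2 * m) j x S))) (P x) ≤ r}
  have hE : ∀ x, 3 / 4 ≤ prob (iidSample base m) (E x) := by
    intro x
    have hmem : P x ∈ classC B g := by
      refine ⟨codeIndex hB (2 * m) x, j, ?_, hj, hk, ?_⟩
      · rw [apply_codeIndex hB]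
        exact hne x
      · simp only [P, apply_codeIndex]
    have h := hAM (P x) hmem _ (Set.mem_singleton _) ε ⟨hε0, hε1⟩ (1 / 4)
      ⟨by norm_num, by norm_num⟩ m (le_max_left _ _)
    -- The guarantee for `P x` is pulled back along the encoding to an event for the base sample,
    -- whose law does not depend on `x`.
    rw [corruptedSample_pure, prob_map,
      show P x = base.map (encodePoint hB (2 * m) j x) from
        (map_encodePoint_mixture hB (2 * m) j x (hne x)).symm, iidSample_map, prob_map,
      show base.map (encodePoint hB (2 * m) j x) = P x from
        map_encodePoint_mixture hB (2 * m) j x (hne x)] at h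
    refine le_trans (by norm_num) h
  let N : Set Sample := {S | 1 / (8 * α * j) * m ≤ S.countP (·.2 = 2 * j + 2)}
  have hN : prob (iidSample base m) N ≤ 1 / 8 := by
    have h := mul_prob_le_countP_le base (·.2 = 2 * j + 2) m
      (t := 1 / (8 * α * j) * m) (by positivity)
    rw [prob_mixture_marker] at h
    have h1 : (1 : ℝ) / g j ≤ 1 / (64 * α * j) := one_div_le_one_div_of_le (by positivity) hg
    have h2 : 1 / (8 * α * j) * m * prob (iidSample base m) N ≤
        1 / (8 * α * j) * m * (1 / 8) := by
      refine h.trans ?_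
      calc m * (1 / g j) ≤ m * (1 / (64 * α * j)) := by gcongr
        _ = 1 / (8 * α * j) * m * (1 / 8) := by field_simp; norm_num
    exact le_of_mul_le_mul_left h2 (by positivity)
  have hhalf : ∀ S ∈ (iidSample base m).support, S ∉ N →
      ∀ J ⊆ (Finset.range (2 * m)).powerset, (∀ x ∈ J, S ∈ E x) →
        2 * J.card ≤ (Finset.range (2 * m)).powerset.card := by
    intro S hS hSN J hJ hJE
    have hcard : S.card = m := card_of_mem_support_iidSample hS
    have hcount : (S.countP (·.2 = 2 * j + 2) : ℝ) ≤ 1 / (8 * α * j) * m :=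
      (not_le.1 (show ¬ 1 / (8 * α * j) * m ≤ (S.countP (·.2 = 2 * j + 2) : ℝ) from hSN)).le
    -- For fixed `S` the flip is injective and leads out of `J`: the learner gets the same input
    -- from `x` and from its flip, and cannot be `r`-close to both targets.
    have hflip : J.card ≤ ((Finset.range (2 * m)).powerset \ J).card := by
      refine Finset.card_le_card_of_injOn (flipUnseen (2 * m) j S) ?_ ?_
      · intro x hx
        have hxr := Finset.mem_powerset.1 (hJ hx)
        refine Finset.mem_sdiff.2 ⟨Finset.mem_powerset.2 (flipUnseen_subset S hxr), fun hx' => ?_⟩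
        have h1 : tvDist (A (f (encodeSample hB (2 * m) j x S))) (P x) ≤ r := hJE x hx
        have h2 : tvDist (A (f (encodeSample hB (2 * m) j (flipUnseen (2 * m) j S x) S)))
          (P (flipUnseen (2 * m) j S x)) ≤ r := hJE _ hx'
        rw [hf m x S hxr hcard hcount] at h2
        have h3 := card_sdiff_le_of_tvDist_le h1 h2
        have h4 := card_le_card_codeSet_sdiff x
          (Finset.sdiff_subset (s := Finset.range (2 * m)) (t := seenIndices j S))
        have h5 : m ≤ (Finset.range (2 * m) \ seenIndices j S).card := by
          have := Finset.le_card_sdiff (seenIndices j S) (Finset.range (2 * m))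
          have := card_seenIndices_le j S
          rw [Finset.card_range] at *
          omega
        have h6 : (m : ℝ) ≤ (codeSet (2 * m) x \ codeSet (2 * m)
            (flipUnseen (2 * m) j S x)).card := by exact_mod_cast h5.trans h4
        have h7 : (1 : ℝ) / 2 ≤ (codeSet (2 * m) x \ codeSet (2 * m)
            (flipUnseen (2 * m) j S x)).card / (codeSet (2 * m) x).card := by
          rw [card_codeSet, le_div_iff₀ (by positivity)]
          push_cast
          linarith
        have h8 : (1 : ℝ) / g j ≤ 1 / (64 * j) :=
          one_div_le_one_div_of_le (by positivity) (by nlinarith)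
        have h9 : (63 : ℝ) / 64 * (1 / j) ≤ 1 / j - 1 / g j := by
          have : (1 : ℝ) / (64 * j) = 1 / 64 * (1 / j) := by field_simp
          linarith
        have h10 : (0 : ℝ) < 1 / j := by positivity
        -- Closeness to both would force `63/128 * (1/j) ≤ 2 * r`, whereas `2 * r = 48/128 * (1/j)`.
        have h11 : (63 : ℝ) / 64 * (1 / j) * (1 / 2) ≤ 2 * r :=
          (mul_le_mul h9 h7 (by norm_num) (by linarith)).trans h3
        have h12 : r = 3 / 16 * (1 / j) := by rw [hr']; field_simp
        linarith
      · intro x _ y _ hxy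
        rw [← flipUnseen_flipUnseen (n := 2 * m) (j := j) S x,
          ← flipUnseen_flipUnseen (n := 2 * m) (j := j) S y]
        exact congrArg _ hxy
    have := Finset.card_sdiff_add_card_eq_card hJ
    omega
  -- With `N` of probability at most `1/8`, the average success is at most `5/8`, against the
  -- required `3/4`.
  have hsum := two_mul_sum_prob_le (iidSample base m) _ E N hhalf
  have hlow := Finset.card_nsmul_le_sum (Finset.range (2 * m)).powerset
    (fun x => prob (iidSample base m) (E x)) (3 / 4) fun x _ => hE x
  rw [nsmul_eq_mul] at hlow
  have hpos : (0 : ℝ) < (Finset.range (2 * m)).powerset.card := by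
    exact_mod_cast Finset.card_pos.2 ⟨∅, Finset.empty_mem_powerset _⟩
  nlinarith

end LowerBound

/-! ### The two adversaries and their budgets. -/

section Adversaries

theorem hasConstantBudget_of_floor {b : ℕ → ℝ} {η : ℝ} (h0 : 0 ≤ η) (h1 : η ≤ 1)
    (hb : ∀ m : ℕ, b m = (⌊η * m⌋₊ : ℝ) / m) : HasConstantBudget b η := by
  refine ⟨h0, h1, fun m => ?_⟩
  rcases Nat.eq_zero_or_pos m with rfl | hm
  · simp
  · have hm0 : (m : ℝ) ≠ 0 := by positivity
    rw [hb, mul_div_cancel₀ _ hm0]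
    exact ⟨by linarith [Nat.lt_floor_add_one (η * m)], Nat.floor_le (by positivity)⟩

theorem sSup_deterministic_budget {φ : ℝ → ℝ → ℝ} {f : Sample → Sample} {m : ℕ} {c : ℝ}
    (h : ∀ S : Sample, S.card = m → φ S.card (f S).card = c) :
    sSup {r : ℝ | ∃ S : Sample, S.card = m ∧ ∃ T ∈ (PMF.pure (f S)).support,
      r = φ S.card T.card} = c := by
  have : {r : ℝ | ∃ S : Sample, S.card = m ∧ ∃ T ∈ (PMF.pure (f S)).support,
      r = φ S.card T.card} = {c} := by
    ext r
    simp only [PMF.support_pure, Set.mem_singleton_iff, Set.mem_ofPred_eq, exists_eq_left]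
    constructor
    · rintro ⟨S, hS, rfl⟩
      exact h S hS
    · rintro rfl
      exact ⟨Multiset.replicate m (0, 0), Multiset.card_replicate _ _,
        (h _ (Multiset.card_replicate _ _)).symm⟩
  rw [this, csSup_singleton]

theorem pure_mem_additiveAdversaries {f : Sample → Sample} {η : ℝ} (h0 : 0 ≤ η) (h1 : η ≤ 1)
    (hle : ∀ S, S ≤ f S) (hcard : ∀ S, (f S).card = S.card + ⌊η * S.card⌋₊) :
    ((fun S => PMF.pure (f S), η) : Adversary × ℝ) ∈ additiveAdversaries := by
  refine ⟨fun S T hT => ?_, fun S₁ S₂ h T₁ hT₁ T₂ hT₂ => ?_,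
    hasConstantBudget_of_floor h0 h1 fun m => ?_⟩
  · simp only [PMF.support_pure, Set.mem_singleton_iff] at hT
    exact hT ▸ hle S
  · simp only [PMF.support_pure, Set.mem_singleton_iff] at hT₁ hT₂
    rw [hT₁, hT₂, hcard, hcard, h]
  · refine sSup_deterministic_budget (φ := fun s t => (t - s) / m) fun S hS => ?_
    rw [hcard, hS]
    push_cast
    ring

theorem pure_mem_subtractiveAdversaries {f : Sample → Sample} {η : ℝ} (h0 : 0 ≤ η) (h1 : η ≤ 1)
    (hle : ∀ S, f S ≤ S) (hcard : ∀ S, (f S).card = S.card - ⌊η * S.card⌋₊) :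
    ((fun S => PMF.pure (f S), η) : Adversary × ℝ) ∈ subtractiveAdversaries := by
  refine ⟨fun S T hT => ?_, fun S₁ S₂ h T₁ hT₁ T₂ hT₂ => ?_,
    hasConstantBudget_of_floor h0 h1 fun m => ?_⟩
  · simp only [PMF.support_pure, Set.mem_singleton_iff] at hT
    exact hT ▸ hle S
  · simp only [PMF.support_pure, Set.mem_singleton_iff] at hT₁ hT₂
    rw [hT₁, hT₂, hcard, hcard, h]
  · refine sSup_deterministic_budget (φ := fun s t => (s - t) / m) fun S hS => ?_
    have : ⌊η * m⌋₊ ≤ m := Nat.floor_le_of_le (mul_le_of_le_one_left (Nat.cast_nonneg m) h1)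
    rw [hcard, hS, Nat.cast_sub this]
    ring

variable {B : ℕ → Finset ℕ} (hB : Function.Surjective B) (j : ℕ) (η : ℝ)

/-- The marker `(i', 2j+2)` such that `B i'` encodes the same as `B i` on the indices revealed by
the sample and the opposite on all others. -/
noncomputable def decoy (S : Sample) (a : Point) : Point :=
  (codeIndex hB (2 * S.card) (symmDiff (decodeSet (2 * S.card) (B a.1))
    (Finset.range (2 * S.card) \ revealedIndices j S)), 2 * j + 2)

/-- Adds a decoy for every marker in the sample, budget permitting, and fills up with `(0, 0)`. -/
noncomputable def addDecoys (S : Sample) : Sample :=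
  S + if S.countP (·.2 = 2 * j + 2) ≤ ⌊η * S.card⌋₊ then
    (S.filter (·.2 = 2 * j + 2)).map (decoy hB j S) +
      Multiset.replicate (⌊η * S.card⌋₊ - S.countP (·.2 = 2 * j + 2)) (0, 0)
  else Multiset.replicate ⌊η * S.card⌋₊ (0, 0)

theorem card_addDecoys (S : Sample) :
    (addDecoys hB j η S).card = S.card + ⌊η * S.card⌋₊ := by
  rw [addDecoys, Multiset.card_add]
  split_ifs with h
  · rw [Multiset.card_add, Multiset.card_map, Multiset.card_replicate,
      ← Multiset.countP_eq_card_filter, Nat.add_sub_cancel' h]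
  · rw [Multiset.card_replicate]

theorem countP_marker_encodeSample (n : ℕ) (x : Finset ℕ) (S : Sample) :
    (encodeSample hB n j x S).countP (·.2 = 2 * j + 2) = S.countP (·.2 = 2 * j + 2) := by
  rw [Multiset.countP_eq_card_filter, filter_marker_encodeSample, Multiset.card_replicate]

/-- In this form `x` and its flip play symmetric roles: the last two summands are their markers in
equal number, and the rest is the same for both. -/
theorem addDecoys_encodeSample {m : ℕ} {x : Finset ℕ} {S : Sample}
    (hx : x ⊆ Finset.range (2 * m)) (hS : S.card = m)
    (h : S.countP (·.2 = 2 * j + 2) ≤ ⌊η * m⌋₊) :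
    addDecoys hB j η (encodeSample hB (2 * m) j x S) =
      (encodeSample hB (2 * m) j x S).filter (¬ ·.2 = 2 * j + 2) +
      Multiset.replicate (⌊η * m⌋₊ - S.countP (·.2 = 2 * j + 2)) (0, 0) +
      (Multiset.replicate (S.countP (·.2 = 2 * j + 2)) (codeIndex hB (2 * m) x, 2 * j + 2) +
      Multiset.replicate (S.countP (·.2 = 2 * j + 2))
        (codeIndex hB (2 * m) (flipUnseen (2 * m) j S x), 2 * j + 2)) := by
  rw [addDecoys, countP_marker_encodeSample, card_encodeSample, hS, if_pos h,
    filter_marker_encodeSample, Multiset.map_replicate]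
  have hd : decoy hB j (encodeSample hB (2 * m) j x S) (codeIndex hB (2 * m) x, 2 * j + 2) =
      (codeIndex hB (2 * m) (flipUnseen (2 * m) j S x), 2 * j + 2) := by
    simp only [decoy, card_encodeSample, hS, apply_codeIndex, decodeSet_codeSet hx,
      revealedIndices_encodeSample, flipUnseen]
  rw [hd]
  conv_lhs => rw [← Multiset.filter_add_not (·.2 = 2 * j + 2) (encodeSample hB (2 * m) j x S),
    filter_marker_encodeSample]
  abel

theorem addDecoys_encodeSample_flipUnseen {m : ℕ} {x : Finset ℕ} {S : Sample}
    (hx : x ⊆ Finset.range (2 * m)) (hS : S.card = m)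
    (h : S.countP (·.2 = 2 * j + 2) ≤ ⌊η * m⌋₊) :
    addDecoys hB j η (encodeSample hB (2 * m) j (flipUnseen (2 * m) j S x) S) =
      addDecoys hB j η (encodeSample hB (2 * m) j x S) := by
  rw [addDecoys_encodeSample hB j η hx hS h,
    addDecoys_encodeSample hB j η (flipUnseen_subset S hx) hS h, flipUnseen_flipUnseen,
    filter_not_marker_encodeSample_flipUnseen]
  congr 1
  exact add_comm _ _

/-- Some `t` elements of the multiset. -/
noncomputable def truncate (t : ℕ) (S : Sample) : Sample := (S.toList.take t : List Point)

theorem truncate_le (t : ℕ) (S : Sample) : truncate t S ≤ S := by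
  conv_rhs => rw [← S.coe_toList]
  exact Multiset.coe_le.2 (List.take_sublist _ _).subperm

theorem card_truncate {t : ℕ} {S : Sample} (h : t ≤ S.card) : (truncate t S).card = t := by
  simp [truncate, h]

/-- Removes all markers from the sample, budget permitting, and then arbitrary points until the
budget is used up. -/
noncomputable def removeMarkers (S : Sample) : Sample :=
  truncate (S.card - ⌊η * S.card⌋₊) (if S.countP (·.2 = 2 * j + 2) ≤ ⌊η * S.card⌋₊ then
    S.filter (¬ ·.2 = 2 * j + 2) else S)

theorem removeMarkers_le (S : Sample) : removeMarkers j η S ≤ S := by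
  refine (truncate_le _ _).trans ?_
  split_ifs
  · exact Multiset.filter_le _ _
  · exact le_rfl

theorem card_removeMarkers (S : Sample) :
    (removeMarkers j η S).card = S.card - ⌊η * S.card⌋₊ := by
  refine card_truncate ?_
  split_ifs with h
  · have := Multiset.card_eq_countP_add_countP (·.2 = 2 * j + 2) S
    rw [← Multiset.countP_eq_card_filter]
    omega
  · exact Nat.sub_le _ _

/-- Without markers the two samples are already equal, so the arbitrary choice made in truncating
them is the same. -/
theorem removeMarkers_encodeSample_flipUnseen {m : ℕ} {x : Finset ℕ} {S : Sample}
    (hS : S.card = m) (h : S.countP (·.2 = 2 * j + 2) ≤ ⌊η * m⌋₊) :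
    removeMarkers j η (encodeSample hB (2 * m) j (flipUnseen (2 * m) j S x) S) =
      removeMarkers j η (encodeSample hB (2 * m) j x S) := by
  simp only [removeMarkers, card_encodeSample, countP_marker_encodeSample, hS, if_pos h,
    filter_not_marker_encodeSample_flipUnseen]

theorem Superlinear.exists_nat {g : ℝ → ℝ} (hg : Superlinear g) (c : ℝ) :
    ∃ j : ℕ, (1 : ℝ) ≤ j ∧ c * j ≤ g j := by
  obtain ⟨j, hc, hj⟩ := (((tendsto_natCast_atTop_atTop (R := ℝ)).eventually
    (hg.eventually_ge_atTop c)).and (eventually_ge_atTop 1)).exists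
  have hj1 : (1 : ℝ) ≤ j := by exact_mod_cast hj
  exact ⟨j, hj1, (le_div_iff₀ (by linarith)).1 hc⟩

theorem RobustlyLearnable.anti {C : Set (PMF Point)} {α : ℝ} {𝒱 𝒲 : Set (Adversary × ℝ)}
    (h : RobustlyLearnable C α 𝒱) (hsub : 𝒲 ⊆ 𝒱) : RobustlyLearnable C α 𝒲 := by
  obtain ⟨A, M, hAM⟩ := h
  exact ⟨A, M, fun p hp v hv => hAM p hp v (hsub hv)⟩

theorem one_div_mem_Icc {α : ℝ} (hα : 1 ≤ α) {j : ℕ} (hj : (1 : ℝ) ≤ j) :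
    0 ≤ 1 / (8 * α * j) ∧ 1 / (8 * α * j) ≤ 1 := by
  have h : 1 ≤ 8 * α * j := by nlinarith
  exact ⟨by positivity, (div_le_one (by linarith)).2 h⟩

theorem additivelyUnlearnable_classC {B : ℕ → Finset ℕ} (hB : Function.Surjective B) {g : ℝ → ℝ} (hg : Superlinear g) :
    AdditivelyUnlearnable (classC B g) := by
  intro α hα
  obtain ⟨j, hj, hgj⟩ := hg.exists_nat (64 * α)
  obtain ⟨h0, h1⟩ := one_div_mem_Icc hα hj
  have hmem := pure_mem_additiveAdversaries h0 h1
    (f := addDecoys hB j (1 / (8 * α * j))) (fun S => Multiset.le_add_right _ _)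
    (card_addDecoys hB j _)
  have huniv := not_robustlyLearnable_of_flipUnseen hB hα hj hgj
    (addDecoys hB j (1 / (8 * α * j))) fun m x S hx hS h =>
      addDecoys_encodeSample_flipUnseen hB j _ hx hS (Nat.le_floor h)
  exact ⟨fun h => huniv (h.anti (Set.singleton_subset_iff.2 hmem)), _, hmem, huniv⟩

theorem subtractivelyUnlearnable_classC {B : ℕ → Finset ℕ} (hB : Function.Surjective B) {g : ℝ → ℝ} (hg : Superlinear g) :
    SubtractivelyUnlearnable (classC B g) := by
  intro α hα
  obtain ⟨j, hj, hgj⟩ := hg.exists_nat (64 * α)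
  obtain ⟨h0, h1⟩ := one_div_mem_Icc hα hj
  have hmem := pure_mem_subtractiveAdversaries h0 h1
    (f := removeMarkers j (1 / (8 * α * j))) (removeMarkers_le j _) (card_removeMarkers j _)
  have huniv := not_robustlyLearnable_of_flipUnseen hB hα hj hgj
    (removeMarkers j (1 / (8 * α * j))) fun m x S _ hS h =>
      removeMarkers_encodeSample_flipUnseen hB j _ hS (Nat.le_floor h)
  exact ⟨fun h => huniv (h.anti (Set.singleton_subset_iff.2 hmem)), _, hmem, huniv⟩

end Adversaries

end AdaptiveLearning

theorem theorem1 (B : ℕ → Finset ℕ) (hB : Function.Surjective B)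
    (g : ℝ → ℝ) (hg : AdaptiveLearning.Superlinear g) :
    ((MonotoneOn g (Set.Ici 1) →
        AdaptiveLearning.RealizablyLearnableAtRate (AdaptiveLearning.classC B g) g) ∧
      AdaptiveLearning.AdditivelyUnlearnable (AdaptiveLearning.classC B g) ∧
      AdaptiveLearning.SubtractivelyUnlearnable (AdaptiveLearning.classC B g)) ∧
    ∃ h : ℝ → ℝ, AdaptiveLearning.Superlinear h ∧
      AdaptiveLearning.RealizablyLearnableAtRate (AdaptiveLearning.classC B h) g ∧
      AdaptiveLearning.AdditivelyUnlearnable (AdaptiveLearning.classC B h) ∧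
      AdaptiveLearning.SubtractivelyUnlearnable (AdaptiveLearning.classC B h) := by
  obtain ⟨h, hsuper, hle⟩ := hg.exists_lower_envelope
  refine ⟨⟨fun hmono => ?_, AdaptiveLearning.additivelyUnlearnable_classC hB hg,
    AdaptiveLearning.subtractivelyUnlearnable_classC hB hg⟩, h, hsuper, ?_,
    AdaptiveLearning.additivelyUnlearnable_classC hB hsuper,
    AdaptiveLearning.subtractivelyUnlearnable_classC hB hsuper⟩
  · exact AdaptiveLearning.realizablyLearnableAtRate_of_le fun j hj _ x hx =>
      hmono (Set.mem_Ici.2 hj) (Set.mem_Ici.2 (hj.trans hx.le)) hx.le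
  -- Membership in the class forces `1 ≤ j ≤ h j`, so the envelope is positive at `j` and bounds `g`
  -- from there on.
  · exact AdaptiveLearning.realizablyLearnableAtRate_of_le fun j hj hk x hx =>
      hle j (by linarith) x hx.le
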